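/- Let $\mathbb T_L^d=(\mathbb R/L\mathbb Z)^d$ be the $d$-dimensional torus of side $L>0$ with Lebesgue measure and flat distance $|\cdot|$ to the origin, and let $a<L$. Let $V\in L^1(\mathbb T_L^d)$ be a real potential whose negative part is in $L^\infty$, which is symmetric ($V(-x)=V(x)$ for a.e. $x$) and of finite range ($V(x)=0$ for a.e. $x$ with $|x|>a$). Let $\mathscr P$ be the set of probability densities on $\mathbb T_L^d$ and $\rho_0= L^{-d}\in\mathscr P$ the uniform density. For $\rho\in\mathscr P$ and $\theta\ge 0$ put $$\mathcal S(\rho)=\int_{\mathbb T_L^d}\rho\log\rho\,dx,\qquad \mathcal E(\rho,\rho)=\int_{\mathbb T_L^d\times\mathbb T_L^d}V(x-y)\rho(x)\rho(y)\,dx\,dy,\qquad \mathcal F_\theta(\rho)=\mathcal S(\rho)+\tfrac12\theta\rho_0^{-1}\mathcal E(\rho,\rho),$$ with values in $(-\infty,+\infty]$ (and $0\log 0=0$, $0\cdot\infty=0$). Let $\mathscr M_\theta$ be the set of minimizers of $\mathcal F_\theta$ over $\mathscr P$, and let $$E_\theta=\inf_{\rho\in\mathscr M_\theta}\tfrac12\theta\rho_0^{-1}\mathcal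 E(\rho,\rho),\qquad S_\theta=\inf_{\rho\in\mathscr M_\theta}\mathcal S(\rho),\qquad F_\theta=\inf_{\rho\in\mathscr P}\mathcal F_\theta(\rho).$$ Then for every $\theta\ge0$ the set $\mathscr M_\theta$ is non-empty and $E_\theta$, $S_\theta$, $F_\theta$ are finite, and: (a) $\theta\mapsto S_\theta$ is non-decreasing on $[0,\infty)$; (b) $\theta\mapsto F_\theta-\tfrac12\theta\rho_0^{-1}\mathcal E(\rho_0,\rho_0)$ is non-increasing and continuous on $[0,\infty)$; (c) $\theta\mapsto\theta^{-1}E_\theta$ is non-increasing on $(0,\infty)$, and $\theta\mapsto E_\theta-\tfrac12\theta\rho_0^{-1}\mathcal E(\rho_0,\rho_0)$ is non-increasing on $[0,\infty)$. -/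

import Mathlib

open MeasureTheory Set

noncomputable section

namespace McKeanVlasov

/-- The `d`-dimensional torus of side length `L`; its `volume` is Lebesgue measure,
of total mass `L ^ d`. -/
abbrev Torus (d : ℕ) (L : ℝ) : Type := Fin d → AddCircle L

/-- The Euclidean (flat) distance of a point of the torus to the origin. The norm on `AddCircle L`
is the distance of a representative to the nearest multiple of `L`. -/
def Torus.dist₀ {d : ℕ} {L : ℝ} (x : Torus d L) : ℝ := √(∑ i, ‖x i‖ ^ 2)

/-- The class of interaction potentials of range `a`, as functions on the torus
(identified when they agree almost everywhere): integrable, with essentially bounded negative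
part, symmetric, and vanishing at distance more than `a` from the origin. -/
structure IsPotential {d : ℕ} {L : ℝ} [Fact (0 < L)] (a : ℝ) (V : Torus d L → ℝ) : Prop where
  integrable : Integrable V volume
  negPart_bounded : MemLp (fun x => max (-V x) 0) ⊤ volume
  symmetric : ∀ᵐ x ∂(volume : Measure (Torus d L)), V (-x) = V x
  finite_range : ∀ᵐ x ∂(volume : Measure (Torus d L)), a < x.dist₀ → V x = 0

/-- Probability densities on the torus. -/
structure IsDensity {d : ℕ} {L : ℝ} [Fact (0 < L)] (ρ : Torus d L → ℝ) : Prop where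
  integrable : Integrable ρ volume
  nonneg : ∀ᵐ x ∂(volume : Measure (Torus d L)), 0 ≤ ρ x
  integral_eq_one : ∫ x, ρ x = 1

/-- The constant value `L ^ (-d)` of the uniform density. -/
def rho₀ (d : ℕ) (L : ℝ) : ℝ := (L ^ d)⁻¹

open Classical in
/-- The integral of a measurable function whose negative part is integrable, as an extended real
number: it is `+∞` exactly when the function is not integrable. -/
def extIntegral {α : Type*} [MeasurableSpace α] (μ : Measure α) (f : α → ℝ) : EReal :=
  if Integrable f μ then ((∫ x, f x ∂μ : ℝ) : EReal) else ⊤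

/-- The entropy term `∫ ρ log ρ dx`. The integrand is bounded below and the torus has finite
volume, so the integral makes sense in `(-∞, +∞]` for every density. Here `0 log 0 = 0`. -/
def entropy {d : ℕ} {L : ℝ} [Fact (0 < L)] (ρ : Torus d L → ℝ) : EReal :=
  extIntegral volume (fun x => ρ x * Real.log (ρ x))

/-- The interaction `∫∫ V (x - y) ρa x ρb y dx dy`. For densities `ρa`, `ρb` the negative part of
the integrand is integrable when the negative part of `V` is bounded. -/
def energy {d : ℕ} {L : ℝ} [Fact (0 < L)] (V ρa ρb : Torus d L → ℝ) : EReal :=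
  extIntegral ((volume : Measure (Torus d L)).prod volume)
    (fun p => V (p.1 - p.2) * ρa p.1 * ρb p.2)

/-- The energy term `½ θ ρ₀⁻¹ E(ρ, ρ)` (with `0 · ∞ = 0`). -/
def energyTerm {d : ℕ} {L : ℝ} [Fact (0 < L)] (V : Torus d L → ℝ) (θ : ℝ)
    (ρ : Torus d L → ℝ) : EReal :=
  ((1 / 2 * θ * (rho₀ d L)⁻¹ : ℝ) : EReal) * energy V ρ ρ

/-- The free energy functional. -/
def freeEnergy {d : ℕ} {L : ℝ} [Fact (0 < L)] (V : Torus d L → ℝ) (θ : ℝ)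
    (ρ : Torus d L → ℝ) : EReal :=
  entropy ρ + energyTerm V θ ρ

/-- The set of densities that minimize the free energy functional among all densities. -/
def minimizers {d : ℕ} {L : ℝ} [Fact (0 < L)] (V : Torus d L → ℝ) (θ : ℝ) :
    Set (Torus d L → ℝ) :=
  {ρ | IsDensity ρ ∧ ∀ σ, IsDensity σ → freeEnergy V θ ρ ≤ freeEnergy V θ σ}

/-- The equilibrium energy: infimum of the energy term over the minimizers. -/
def Eθ {d : ℕ} {L : ℝ} [Fact (0 < L)] (V : Torus d L → ℝ) (θ : ℝ) : EReal :=
  ⨅ ρ ∈ minimizers V θ, energyTerm V θ ρ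

/-- The equilibrium entropy: infimum of the entropy term over the minimizers. -/
def Sθ {d : ℕ} {L : ℝ} [Fact (0 < L)] (V : Torus d L → ℝ) (θ : ℝ) : EReal :=
  ⨅ ρ ∈ minimizers V θ, entropy ρ

/-- The equilibrium free energy: infimum of the free energy functional over all densities. -/
def Fθ {d : ℕ} {L : ℝ} [Fact (0 < L)] (V : Torus d L → ℝ) (θ : ℝ) : EReal :=
  ⨅ ρ ∈ {ρ : Torus d L → ℝ | IsDensity ρ}, freeEnergy V θ ρ

end McKeanVlasov

end

open Filter Topology
open scoped ENNReal NNReal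

/-! Existence is the direct method. The entropy is bounded below by `log ρ₀` (Gibbs) and the
interaction because `V` is, so along a minimizing sequence at `θ > 0` both are bounded. Bounded
entropy makes the measures uniformly absolutely continuous, which gives an absolutely continuous
setwise limit along an ultrafilter. This convergence passes to product measures, and integrals of
functions bounded below are lower semicontinuous under it; that handles the interaction, and Gibbs'
inequality reduces the entropy to the same fact (`exists_limit_density`).

The rest is comparison of lines. A density with entropy `s` and interaction `e` has free energy `s +
θ e / (2ρ₀)`, affine in `θ`. Testing minimizers at `θ < θ'` against each other and adding gives `e'
≤ e`, and then `s ≤ s'`. The uniform density has least entropy, so at each `θ` some minimizer has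
interaction at most the uniform value `e₀`. Relative to the uniform density, the lines realized by
these minimizers have slopes that are nonpositive and bounded below, hence the free energy is
non-increasing and Lipschitz. -/

namespace McKeanVlasov

/-! ### Setwise compactness of uniformly absolutely continuous measures -/

section Setwise

variable {X : Type*} [MeasurableSpace X]

/-- Uniform absolute continuity of a sequence of measures with respect to `ν`. -/
def UniformlyAbsCont (μ : ℕ → Measure X) (ν : Measure X) : Prop :=
  ∀ ε : ℝ≥0∞, ε ≠ 0 → ∃ K : ℝ≥0∞, K ≠ ⊤ ∧ ∀ n A, MeasurableSet A → μ n A ≤ K * ν A + ε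

/-- Convergence of measures on every measurable set. -/
def SetwiseTendsto (μ : ℕ → Measure X) (l : Filter ℕ) (μ' : Measure X) : Prop :=
  ∀ A, MeasurableSet A → Tendsto (fun n => μ n A) l (𝓝 (μ' A))

/-- Apply the bound to one factor on the sections of `A`, exchange the order of integration, and
apply it to the other factor. The second tolerance has to be chosen after `K`. -/
theorem UniformlyAbsCont.prod {μ : ℕ → Measure X} {ν : Measure X} [IsFiniteMeasure ν]
    [∀ n, IsProbabilityMeasure (μ n)] (h : UniformlyAbsCont μ ν) :
    UniformlyAbsCont (fun n => (μ n).prod (μ n)) (ν.prod ν) := by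
  intro ε hε
  have hε2 : ε / 2 ≠ 0 := by simpa using hε
  obtain ⟨K, hK, hKμ⟩ := h (ε / 2) hε2
  have hKν : K * ν univ ≠ ⊤ := ENNReal.mul_ne_top hK (measure_ne_top _ _)
  -- The tolerance is at most `ε / 2` after multiplication by `K * ν univ`; if that mass is `0`, the
  -- tolerance is `⊤` and `⊤ * 0 = 0`.
  obtain ⟨K', hK', hKμ'⟩ := h (ε / 2 / (K * ν univ)) (ENNReal.div_ne_zero.2 ⟨hε2, hKν⟩)
  refine ⟨K * K', ENNReal.mul_ne_top hK hK', fun n A hA => ?_⟩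
  have hfib : ∀ y, (μ n) ((fun x => (x, y)) ⁻¹' A)
      ≤ K' * ν ((fun x => (x, y)) ⁻¹' A) + ε / 2 / (K * ν univ) := fun y =>
    hKμ' n _ (measurable_prodMk_right hA)
  have hm : Measurable fun y => ν ((fun x => (x, y)) ⁻¹' A) := measurable_measure_prodMk_right hA
  have hfubini : ∫⁻ x, ν (Prod.mk x ⁻¹' A) ∂(μ n)
      ≤ K' * (ν.prod ν) A + ε / 2 / (K * ν univ) * ν univ := by
    rw [← Measure.prod_apply hA, Measure.prod_apply_symm hA, Measure.prod_apply_symm hA]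
    calc ∫⁻ y, (μ n) ((fun x => (x, y)) ⁻¹' A) ∂ν
        ≤ ∫⁻ y, (K' * ν ((fun x => (x, y)) ⁻¹' A) + ε / 2 / (K * ν univ)) ∂ν :=
          lintegral_mono hfib
      _ = _ := by
          rw [lintegral_add_right _ measurable_const, lintegral_const_mul _ hm, lintegral_const]
  calc ((μ n).prod (μ n)) A = ∫⁻ x, μ n (Prod.mk x ⁻¹' A) ∂(μ n) := Measure.prod_apply hA
    _ ≤ ∫⁻ x, (K * ν (Prod.mk x ⁻¹' A) + ε / 2) ∂(μ n) :=
        lintegral_mono fun x => hKμ n _ (measurable_prodMk_left hA)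
    _ = K * ∫⁻ x, ν (Prod.mk x ⁻¹' A) ∂(μ n) + ε / 2 := by
        rw [lintegral_add_right _ measurable_const,
          lintegral_const_mul _ (measurable_measure_prodMk_left hA), lintegral_const,
          measure_univ, mul_one]
    _ ≤ K * (K' * (ν.prod ν) A + ε / 2 / (K * ν univ) * ν univ) + ε / 2 := by gcongr
    _ = K * K' * (ν.prod ν) A + (ε / 2 / (K * ν univ) * (K * ν univ) + ε / 2) := by ring
    _ ≤ K * K' * (ν.prod ν) A + (ε / 2 + ε / 2) := by
        gcongr; exact ENNReal.mul_le_of_le_div le_rfl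
    _ = K * K' * (ν.prod ν) A + ε := by rw [ENNReal.add_halves]

/-- A uniformly absolutely continuous sequence of measures converges setwise along every
ultrafilter. -/
theorem UniformlyAbsCont.exists_setwiseTendsto {μ : ℕ → Measure X} {ν : Measure X}
    [IsFiniteMeasure ν] (h : UniformlyAbsCont μ ν) (l : Ultrafilter ℕ) :
    ∃ μ' : Measure X, μ' ≪ ν ∧ SetwiseTendsto μ l μ' := by
  -- `ℝ≥0∞` is compact, so the ultrafilter assigns a limit to every set at once.
  have hlim : ∀ A : Set X, ∃ c, Tendsto (fun n => μ n A) l (𝓝 c) := fun A =>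
    ⟨(l.map fun n => μ n A).lim, (l.map fun n => μ n A).le_nhds_lim⟩
  choose m hm using hlim
  have hbound : ∀ ε : ℝ≥0∞, ε ≠ 0 → ∃ K : ℝ≥0∞, K ≠ ⊤ ∧
      ∀ A, MeasurableSet A → m A ≤ K * ν A + ε := fun ε hε => by
    obtain ⟨K, hK, hKμ⟩ := h ε hε
    exact ⟨K, hK, fun A hA => le_of_tendsto' (hm A) fun n => hKμ n A hA⟩
  have hzero : ∀ A, MeasurableSet A → ν A = 0 → m A = 0 := fun A hA hνA => by
    by_contra hne
    have hne2 : m A / 2 ≠ 0 := by simpa using hne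
    obtain ⟨K, hK, hKm⟩ := hbound 1 one_ne_zero
    have hfin : m A ≠ ⊤ := ne_top_of_le_ne_top ENNReal.one_ne_top (by simpa [hνA] using hKm A hA)
    obtain ⟨K, hK, hKm⟩ := hbound (m A / 2) hne2
    have := hKm A hA
    rw [hνA, mul_zero, zero_add] at this
    exact absurd this (not_le.2 (ENNReal.half_lt_self hne hfin))
  have hunion : ∀ A B, MeasurableSet B → Disjoint A B → m (A ∪ B) = m A + m B :=
    fun A B hB hAB => tendsto_nhds_unique (hm _)
      (((hm A).add (hm B)).congr fun n => (measure_union hAB hB).symm)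
  have hempty : m ∅ = 0 := hzero ∅ .empty measure_empty
  -- Finite additivity survives the limit; countable additivity holds because the tails `t N` have
  -- small `ν`-measure, hence small `m` by the uniform bound.
  have hsigma : ∀ f : ℕ → Set X, (∀ i, MeasurableSet (f i)) → Pairwise (Function.onFun Disjoint f) →
      m (⋃ i, f i) = ∑' i, m (f i) := fun f hf hd => by
    have hfinite : ∀ N, m (⋃ i ∈ Finset.range N, f i) = ∑ i ∈ Finset.range N, m (f i) := fun N => by
      induction N with
      | zero => simpa using hempty
      | succ N ih =>
        rw [Finset.sum_range_succ, ← ih, ← hunion _ _ (hf N)]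
        · congr 1
          rw [Finset.range_add_one, Finset.set_biUnion_insert, union_comm]
        · rw [disjoint_iUnion₂_left]
          intro i hi
          exact hd (Finset.mem_range.1 hi).ne
    let t : ℕ → Set X := fun N => (⋃ i, f i) \ ⋃ i ∈ Finset.range N, f i
    have hpm : ∀ N, MeasurableSet (⋃ i ∈ Finset.range N, f i) := fun N =>
      Finset.measurableSet_biUnion _ fun i _ => hf i
    have htm : ∀ N, MeasurableSet (t N) := fun N => (MeasurableSet.iUnion hf).diff (hpm N)
    have hsplit : ∀ N, m (⋃ i, f i) = ∑ i ∈ Finset.range N, m (f i) + m (t N) := fun N => by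
      rw [← hfinite, ← hunion _ _ (htm N) disjoint_sdiff_right, union_sdiff_cancel]
      exact iUnion₂_subset fun i _ => subset_iUnion f i
    have hνt : Tendsto (fun N => ν (t N)) atTop (𝓝 0) := by
      have hanti : Antitone t := fun N M hNM => sdiff_subset_sdiff_right
        (biUnion_subset_biUnion_left fun i hi =>
          Finset.mem_range.2 ((Finset.mem_range.1 hi).trans_le hNM))
      have hinter : ⋂ N, t N = ∅ := by
        refine eq_empty_of_forall_notMem fun x hx => ?_
        rw [mem_iInter] at hx
        obtain ⟨i, hi⟩ := mem_iUnion.1 (hx 0).1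
        exact (hx (i + 1)).2 (mem_biUnion (Finset.mem_coe.2 (Finset.self_mem_range_succ i)) hi)
      have := tendsto_measure_iInter_atTop (μ := ν) (fun N => (htm N).nullMeasurableSet) hanti
        ⟨0, measure_ne_top _ _⟩
      rwa [hinter, measure_empty] at this
    have hmt : Tendsto (fun N => m (t N)) atTop (𝓝 0) := by
      rw [ENNReal.tendsto_nhds_zero]
      intro ε hε
      have hε2 : ε / 2 ≠ 0 := by simpa using hε.ne'
      obtain ⟨K, hK, hKm⟩ := hbound (ε / 2) hε2
      have hKν : Tendsto (fun N => K * ν (t N)) atTop (𝓝 0) := by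
        simpa using ENNReal.Tendsto.const_mul hνt (Or.inr hK)
      filter_upwards [(ENNReal.tendsto_nhds_zero.1 hKν) (ε / 2) hε2.bot_lt] with N hN
      calc m (t N) ≤ K * ν (t N) + ε / 2 := hKm _ (htm N)
        _ ≤ ε / 2 + ε / 2 := by gcongr
        _ = ε := ENNReal.add_halves ε
    have hsum := (ENNReal.tendsto_nat_tsum fun i => m (f i)).add hmt
    rw [add_zero] at hsum
    exact tendsto_nhds_unique (tendsto_const_nhds.congr hsplit) hsum
  refine ⟨Measure.ofMeasurable (fun A _ => m A) hempty hsigma, ?_, fun A hA => ?_⟩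
  · refine Measure.AbsolutelyContinuous.mk fun A hA hνA => ?_
    rw [Measure.ofMeasurable_apply A hA]
    exact hzero A hA hνA
  · rw [Measure.ofMeasurable_apply A hA]
    exact hm A

/-- Integrals of nonnegative functions are lower semicontinuous under setwise convergence. -/
theorem SetwiseTendsto.lintegral_le {μ : ℕ → Measure X} {μ' : Measure X} {l : Filter ℕ} [l.NeBot]
    (h : SetwiseTendsto μ l μ') (f : X → ℝ≥0∞) {b : ℕ → ℝ≥0∞} {c : ℝ≥0∞}
    (hb : ∀ n, ∫⁻ x, f x ∂(μ n) ≤ b n) (hc : Tendsto b l (𝓝 c)) : ∫⁻ x, f x ∂μ' ≤ c := by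
  -- Integrals of simple functions with finite values are finite sums of measures of sets, so they
  -- converge; the supremum over them is then lower semicontinuous.
  rw [lintegral_eq_nnreal]
  refine iSup₂_le fun φ hφ => ?_
  have hlim : Tendsto (fun n => (φ.map ENNReal.ofNNReal).lintegral (μ n)) l
      (𝓝 ((φ.map ENNReal.ofNNReal).lintegral μ')) := by
    simp only [SimpleFunc.map_lintegral]
    exact tendsto_finsetSum _ fun r _ =>
      ENNReal.Tendsto.const_mul (h _ (φ.measurableSet_fiber r)) (Or.inr ENNReal.coe_ne_top)
  refine le_of_tendsto_of_tendsto' hlim hc fun n => le_trans ?_ (hb n)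
  rw [lintegral_eq_nnreal]
  exact le_iSup₂ (f := fun (φ : SimpleFunc X ℝ≥0) (_ : ∀ x, (φ x : ℝ≥0∞) ≤ f x) =>
    (φ.map ENNReal.ofNNReal).lintegral (μ n)) φ hφ

theorem SetwiseTendsto.isProbabilityMeasure {μ : ℕ → Measure X} {μ' : Measure X} {l : Filter ℕ}
    [l.NeBot] [∀ n, IsProbabilityMeasure (μ n)] (h : SetwiseTendsto μ l μ') :
    IsProbabilityMeasure μ' :=
  ⟨tendsto_nhds_unique (h univ .univ) (by simp)⟩

/-- Compactness supplies some setwise limit of the products. On rectangles it is the product of the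
limits, which determines it. -/
theorem SetwiseTendsto.prod {μ : ℕ → Measure X} {μ' ν : Measure X} [IsFiniteMeasure ν]
    [∀ n, IsProbabilityMeasure (μ n)] {l : Ultrafilter ℕ} (hν : UniformlyAbsCont μ ν)
    (h : SetwiseTendsto μ l μ') :
    SetwiseTendsto (fun n => (μ n).prod (μ n)) l (μ'.prod μ') := by
  have := h.isProbabilityMeasure
  obtain ⟨μ₂, -, h₂⟩ := hν.prod.exists_setwiseTendsto l
  rw [Measure.prod_eq (μν := μ₂) fun s t hs ht => ?_]
  · exact h₂
  · refine tendsto_nhds_unique (h₂ _ (hs.prod ht)) ?_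
    simp only [Measure.prod_prod]
    exact ENNReal.Tendsto.mul (h s hs) (Or.inr (measure_ne_top _ _)) (h t ht)
      (Or.inr (measure_ne_top _ _))

end Setwise

/-! ### Densities, Gibbs' inequality and lower semicontinuity -/

section Density

variable {X Y : Type*} [MeasurableSpace X] [MeasurableSpace Y]

/-- An everywhere nonnegative, measurable probability density with respect to `ν`. -/
structure IsRegularDensity (ν : Measure X) (ρ : X → ℝ) : Prop where
  measurable : Measurable ρ
  nonneg : ∀ x, 0 ≤ ρ x
  integrable : Integrable ρ ν
  integral_eq_one : ∫ x, ρ x ∂ν = 1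

/-- The measure with density `ρ`. -/
noncomputable def densityMeasure (ν : Measure X) (ρ : X → ℝ) : Measure X :=
  ν.withDensity fun x => ENNReal.ofReal (ρ x)

theorem IsRegularDensity.isProbabilityMeasure {ν : Measure X} {ρ : X → ℝ}
    (h : IsRegularDensity ν ρ) : IsProbabilityMeasure (densityMeasure ν ρ) := by
  refine ⟨?_⟩
  rw [densityMeasure, withDensity_apply _ .univ, Measure.restrict_univ,
    ← ofReal_integral_eq_lintegral_ofReal h.integrable (ae_of_all _ h.nonneg), h.integral_eq_one,
    ENNReal.ofReal_one]

theorem IsRegularDensity.lintegral_densityMeasure {ν : Measure X} {ρ f : X → ℝ}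
    (h : IsRegularDensity ν ρ) (hf : Measurable f) :
    ∫⁻ x, ENNReal.ofReal (f x) ∂(densityMeasure ν ρ) = ∫⁻ x, ENNReal.ofReal (f x * ρ x) ∂ν := by
  rw [densityMeasure, lintegral_withDensity_eq_lintegral_mul _ h.measurable.ennreal_ofReal
    hf.ennreal_ofReal]
  refine lintegral_congr fun x => ?_
  rw [Pi.mul_apply, mul_comm (f x), ENNReal.ofReal_mul (h.nonneg x)]

theorem IsRegularDensity.prod {ν : Measure X} {ν' : Measure Y} [SFinite ν] [SFinite ν']
    {ρ : X → ℝ} {σ : Y → ℝ} (hρ : IsRegularDensity ν ρ) (hσ : IsRegularDensity ν' σ) :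
    IsRegularDensity (ν.prod ν') fun p => ρ p.1 * σ p.2 where
  measurable := (hρ.measurable.comp measurable_fst).mul (hσ.measurable.comp measurable_snd)
  nonneg p := mul_nonneg (hρ.nonneg _) (hσ.nonneg _)
  integrable := hρ.integrable.mul_prod hσ.integrable
  integral_eq_one := by
    rw [integral_prod_mul, hρ.integral_eq_one, hσ.integral_eq_one, one_mul]

theorem IsRegularDensity.densityMeasure_prod {ν : Measure X} {ν' : Measure Y} [SFinite ν]
    [SFinite ν'] {ρ : X → ℝ} {σ : Y → ℝ} (hρ : IsRegularDensity ν ρ)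
    (hσ : IsRegularDensity ν' σ) :
    densityMeasure (ν.prod ν') (fun p => ρ p.1 * σ p.2)
      = (densityMeasure ν ρ).prod (densityMeasure ν' σ) := by
  rw [densityMeasure, densityMeasure, densityMeasure,
    prod_withDensity hρ.measurable.ennreal_ofReal hσ.measurable.ennreal_ofReal]
  congr 1
  ext p
  rw [ENNReal.ofReal_mul (hρ.nonneg _)]

/-- A probability measure absolutely continuous with respect to `ν` has a regular density. -/
theorem exists_isRegularDensity {ν μ : Measure X} [SigmaFinite ν] [IsProbabilityMeasure μ]
    (h : μ ≪ ν) : ∃ ρ, IsRegularDensity ν ρ ∧ densityMeasure ν ρ = μ := by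
  have heq : densityMeasure ν (fun x => (μ.rnDeriv ν x).toReal) = μ := by
    conv_rhs => rw [← Measure.withDensity_rnDeriv_eq μ ν h]
    refine withDensity_congr_ae ?_
    filter_upwards [μ.rnDeriv_ne_top ν] with x hx
    exact ENNReal.ofReal_toReal hx
  refine ⟨fun x => (μ.rnDeriv ν x).toReal, ⟨(μ.measurable_rnDeriv ν).ennreal_toReal,
    fun x => ENNReal.toReal_nonneg, Measure.integrable_toReal_rnDeriv, ?_⟩, heq⟩
  rw [Measure.integral_toReal_rnDeriv h]
  simp

/-- Integrals of functions bounded below against probability densities are lower semicontinuous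
under setwise convergence. -/
theorem SetwiseTendsto.integral_le {ν : Measure X} {r : ℕ → X → ℝ} {r' : X → ℝ}
    (hr : ∀ n, IsRegularDensity ν (r n)) (hr' : IsRegularDensity ν r') {l : Filter ℕ} [l.NeBot]
    (h : SetwiseTendsto (fun n => densityMeasure ν (r n)) l (densityMeasure ν r'))
    {f : X → ℝ} (hf : Measurable f) {C : ℝ} (hC : ∀ x, C ≤ f x)
    (hfi : ∀ n, Integrable (fun x => f x * r n x) ν) {b : ℕ → ℝ} {c : ℝ}
    (hb : ∀ n, ∫ x, f x * r n x ∂ν ≤ b n) (hc : Tendsto b l (𝓝 c)) :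
    Integrable (fun x => f x * r' x) ν ∧ ∫ x, f x * r' x ∂ν ≤ c := by
  have hfC : Measurable fun x => f x - C := hf.sub_const C
  have hshift : ∀ r : X → ℝ, (fun x => (f x - C) * r x) = fun x => f x * r x - C * r x :=
    fun r => by ext x; ring
  have hbn : ∀ n, ∫ x, (f x - C) * r n x ∂ν ≤ b n - C := fun n => by
    rw [hshift, integral_sub (hfi n) ((hr n).integrable.const_mul C), integral_const_mul,
      (hr n).integral_eq_one, mul_one]
    exact sub_le_sub_right (hb n) C
  have hnn : ∀ {r : X → ℝ}, IsRegularDensity ν r → ∀ x, 0 ≤ (f x - C) * r x := fun h x =>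
    mul_nonneg (sub_nonneg.2 (hC x)) (h.nonneg x)
  -- Needed because `ENNReal.ofReal` truncates negative numbers.
  have hcC : 0 ≤ c - C := ge_of_tendsto' (hc.sub_const C) fun n =>
    (integral_nonneg (hnn (hr n))).trans (hbn n)
  have hle : ∫⁻ x, ENNReal.ofReal ((f x - C) * r' x) ∂ν ≤ ENNReal.ofReal (c - C) := by
    rw [← hr'.lintegral_densityMeasure hfC]
    refine h.lintegral_le _ (b := fun n => ENNReal.ofReal (b n - C)) (fun n => ?_)
      (ENNReal.tendsto_ofReal (hc.sub_const C))
    rw [(hr n).lintegral_densityMeasure hfC, ← ofReal_integral_eq_lintegral_ofReal _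
      (ae_of_all _ (hnn (hr n)))]
    · exact ENNReal.ofReal_le_ofReal (hbn n)
    · rw [hshift]
      exact (hfi n).sub ((hr n).integrable.const_mul C)
  have hint : Integrable (fun x => (f x - C) * r' x) ν := by
    refine ⟨(hfC.mul hr'.measurable).aestronglyMeasurable, ?_⟩
    rw [hasFiniteIntegral_iff_ofReal (ae_of_all _ (hnn hr'))]
    exact hle.trans_lt ENNReal.ofReal_lt_top
  have heq : (fun x => f x * r' x) = fun x => (f x - C) * r' x + C * r' x := by ext x; ring
  refine ⟨heq ▸ hint.add (hr'.integrable.const_mul C), ?_⟩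
  rw [heq, integral_add hint (hr'.integrable.const_mul C), integral_const_mul, hr'.integral_eq_one,
    integral_eq_lintegral_of_nonneg_ae (ae_of_all _ (hnn hr')) hint.aestronglyMeasurable]
  have := ENNReal.toReal_mono ENNReal.ofReal_ne_top hle
  rw [ENNReal.toReal_ofReal hcC] at this
  linarith

/-- Fenchel's inequality for `r ↦ r log r`. -/
theorem fenchel_mul_log {r : ℝ} (hr : 0 ≤ r) (g : ℝ) :
    r * g + r - Real.exp g ≤ r * Real.log r := by
  rcases hr.eq_or_lt with rfl | hr
  · simpa using (Real.exp_pos g).le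
  · have h := mul_le_mul_of_nonneg_left (Real.add_one_le_exp (g - Real.log r)) hr.le
    rw [Real.exp_sub, Real.exp_log hr, mul_div_cancel₀ _ hr.ne'] at h
    linarith

/-- Gibbs' inequality. -/
theorem IsRegularDensity.gibbs {ν : Measure X} {ρ : X → ℝ} (h : IsRegularDensity ν ρ)
    (hS : Integrable (fun x => ρ x * Real.log (ρ x)) ν) {g : X → ℝ}
    (hg : Integrable (fun x => ρ x * g x) ν) (he : Integrable (fun x => Real.exp (g x)) ν) :
    ∫ x, ρ x * g x ∂ν + 1 - ∫ x, Real.exp (g x) ∂ν ≤ ∫ x, ρ x * Real.log (ρ x) ∂ν := by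
  have hle := integral_mono ((hg.add h.integrable).sub he) hS fun x =>
    fenchel_mul_log (h.nonneg x) (g x)
  rwa [integral_sub' (hg.add h.integrable) he, integral_add' hg h.integrable,
    h.integral_eq_one] at hle

/-- Densities of bounded entropy are uniformly absolutely continuous. -/
theorem uniformlyAbsCont_of_entropy_le {ν : Measure X} [IsFiniteMeasure ν] {ρ : ℕ → X → ℝ}
    (hρ : ∀ n, IsRegularDensity ν (ρ n))
    (hS : ∀ n, Integrable (fun x => ρ n x * Real.log (ρ n x)) ν) {C : ℝ}
    (hC : ∀ n, ∫ x, ρ n x * Real.log (ρ n x) ∂ν ≤ C) :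
    UniformlyAbsCont (fun n => densityMeasure ν (ρ n)) ν := by
  intro ε hε
  by_cases hεt : ε = ⊤
  · exact ⟨0, ENNReal.zero_ne_top, fun n A _ => by simp [hεt]⟩
  have hε' : 0 < ε.toReal := ENNReal.toReal_pos hε hεt
  -- Fenchel's inequality with `g = M` on `A` and `0` elsewhere bounds `M * ∫ x in A, ρ n x` by a
  -- constant plus `exp M * ν A`; this `M` makes the constant divided by `M` equal to `ε`.
  set M : ℝ := (|C| + ν.real univ + 1) / ε.toReal with hM
  have hpos : 0 < |C| + ν.real univ + 1 := by positivity
  have hMpos : 0 < M := div_pos hpos hε'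
  refine ⟨ENNReal.ofReal (Real.exp M / M), ENNReal.ofReal_ne_top, fun n A hA => ?_⟩
  have hmass : M * ∫ x in A, ρ n x ∂ν ≤ |C| + ν.real univ + 1 + Real.exp M * ν.real A := by
    have h1 : Integrable (A.indicator fun x => M * ρ n x) ν :=
      ((hρ n).integrable.const_mul M).indicator hA
    have h2 : Integrable (A.indicator fun _ => Real.exp M) ν := (integrable_const _).indicator hA
    have hle := integral_mono ((h1.add (hρ n).integrable).sub ((integrable_const (1 : ℝ)).add h2))
      (hS n) fun x => by
        refine le_trans ?_ (fenchel_mul_log ((hρ n).nonneg x) (A.indicator (fun _ => M) x))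
        by_cases hx : x ∈ A
        · simp only [Pi.sub_apply, Pi.add_apply, indicator_of_mem hx]
          linarith [mul_comm M (ρ n x)]
        · simp [indicator_of_notMem hx]
    rw [integral_sub' (h1.add (hρ n).integrable) ((integrable_const (1 : ℝ)).add h2),
      integral_add' h1 (hρ n).integrable, integral_add' (integrable_const (1 : ℝ)) h2,
      integral_indicator hA, integral_indicator hA, integral_const_mul, (hρ n).integral_eq_one,
      setIntegral_const, integral_const, smul_eq_mul, smul_eq_mul] at hle
    linarith [hC n, le_abs_self C, mul_comm (ν.real A) (Real.exp M)]
  change densityMeasure ν (ρ n) A ≤ _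
  rw [densityMeasure, withDensity_apply _ hA, ← ofReal_integral_eq_lintegral_ofReal
    (hρ n).integrable.integrableOn (ae_of_all _ (hρ n).nonneg), ← ENNReal.ofReal_toReal hεt,
    ← ofReal_measureReal (measure_ne_top ν A), ← ENNReal.ofReal_mul (by positivity),
    ← ENNReal.ofReal_add (by positivity) hε'.le]
  refine ENNReal.ofReal_le_ofReal ?_
  have hεM : ε.toReal = (|C| + ν.real univ + 1) / M := by
    rw [hM, div_div_cancel₀ hpos.ne']
  rw [hεM, div_mul_eq_mul_div, ← add_div, le_div_iff₀ hMpos]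
  linarith

/-- The entropy is lower semicontinuous under setwise convergence. -/
theorem SetwiseTendsto.entropy_le {ν : Measure X} [IsFiniteMeasure ν] {r : ℕ → X → ℝ} {ρ : X → ℝ}
    (hr : ∀ n, IsRegularDensity ν (r n)) (hρ : IsRegularDensity ν ρ) {l : Filter ℕ} [l.NeBot]
    (h : SetwiseTendsto (fun n => densityMeasure ν (r n)) l (densityMeasure ν ρ))
    (hS : ∀ n, Integrable (fun x => r n x * Real.log (r n x)) ν) {s : ℝ}
    (hs : Tendsto (fun n => ∫ x, r n x * Real.log (r n x) ∂ν) l (𝓝 s)) :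
    Integrable (fun x => ρ x * Real.log (ρ x)) ν ∧ ∫ x, ρ x * Real.log (ρ x) ∂ν ≤ s := by
  -- Gibbs' inequality for `r n` with the test function `log (ρ + δ)` built from the limit density.
  -- It is bounded below by `log δ`, and its exponential integrates to `1 + δ ν(X)`, whence the
  -- error term.
  have key : ∀ δ : ℝ, 0 < δ → Integrable (fun x => Real.log (ρ x + δ) * ρ x) ν ∧
      ∫ x, Real.log (ρ x + δ) * ρ x ∂ν ≤ s + δ * ν.real univ := fun δ hδ => by
    have hexp : ∀ x, Real.exp (Real.log (ρ x + δ)) = ρ x + δ := fun x =>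
      Real.exp_log (add_pos_of_nonneg_of_pos (hρ.nonneg x) hδ)
    have hlow : ∀ x, Real.log δ ≤ Real.log (ρ x + δ) := fun x =>
      Real.log_le_log hδ (le_add_of_nonneg_left (hρ.nonneg x))
    have hlog : Measurable fun x => Real.log (ρ x + δ) :=
      Real.measurable_log.comp (hρ.measurable.add_const δ)
    have hρδ : Integrable (fun x => ρ x + δ) ν := hρ.integrable.add (integrable_const δ)
    have hint : ∀ n, Integrable (fun x => Real.log (ρ x + δ) * r n x) ν := fun n => by
      refine integrable_of_le_of_le (hlog.mul (hr n).measurable).aestronglyMeasurable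
        (ae_of_all _ fun x => mul_le_mul_of_nonneg_right (hlow x) ((hr n).nonneg x))
        (ae_of_all _ fun x => ?_) ((hr n).integrable.const_mul _)
        (((hS n).add hρδ).sub (hr n).integrable)
      have := fenchel_mul_log ((hr n).nonneg x) (Real.log (ρ x + δ))
      rw [hexp] at this
      simp only [Pi.add_apply, Pi.sub_apply]
      linarith [mul_comm (r n x) (Real.log (ρ x + δ))]
    refine h.integral_le hr hρ hlog hlow hint (fun n => ?_) (hs.add_const (δ * ν.real univ))
    have hg := (hr n).gibbs (hS n) (g := fun x => Real.log (ρ x + δ))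
      (by simpa only [mul_comm] using hint n) (by simpa only [hexp] using hρδ)
    simp only [hexp] at hg
    rw [integral_add hρ.integrable (integrable_const δ), hρ.integral_eq_one, integral_const,
      smul_eq_mul] at hg
    simp only [mul_comm (r n _) (Real.log (ρ _ + δ))] at hg
    linarith [mul_comm δ (ν.real univ)]
  have hmono : ∀ δ : ℝ, 0 < δ → ∀ x, ρ x * Real.log (ρ x) ≤ Real.log (ρ x + δ) * ρ x :=
    fun δ hδ x => by
      rcases (hρ.nonneg x).eq_or_lt with h0 | h0
      · simp [← h0]
      · rw [mul_comm]
        exact mul_le_mul_of_nonneg_right (Real.log_le_log h0 (by linarith)) h0.le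
  have hint : Integrable (fun x => ρ x * Real.log (ρ x)) ν := by
    refine integrable_of_le_of_le
      (hρ.measurable.mul (Real.measurable_log.comp hρ.measurable)).aestronglyMeasurable
      (ae_of_all _ fun x => ?_) (ae_of_all _ (hmono 1 one_pos))
      (hρ.integrable.sub (integrable_const (1 : ℝ))) (key 1 one_pos).1
    simpa using fenchel_mul_log (hρ.nonneg x) 0
  refine ⟨hint, ?_⟩
  -- Since `log ρ ≤ log (ρ + δ)` where `ρ > 0`, only the error term needs `δ → 0`; no limit is taken
  -- under the integral.
  have hlim : Tendsto (fun δ : ℝ => s + δ * ν.real univ) (𝓝[>] 0) (𝓝 s) := by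
    have : Continuous fun δ : ℝ => s + δ * ν.real univ := by fun_prop
    simpa using (this.tendsto 0).mono_left nhdsWithin_le_nhds
  refine ge_of_tendsto hlim ?_
  filter_upwards [self_mem_nhdsWithin] with δ hδ
  exact (integral_mono hint (key δ hδ).1 (hmono δ hδ)).trans (key δ hδ).2

/-- Densities with convergent entropies and convergent interaction energies have a limit density
whose entropy and energy do not exceed the limits. -/
theorem exists_limit_density {ν : Measure X} [IsFiniteMeasure ν] {r : ℕ → X → ℝ}
    (hr : ∀ n, IsRegularDensity ν (r n))
    (hS : ∀ n, Integrable (fun x => r n x * Real.log (r n x)) ν) {C : ℝ}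
    (hC : ∀ n, ∫ x, r n x * Real.log (r n x) ∂ν ≤ C) {W : X × X → ℝ} (hW : Measurable W)
    {B : ℝ} (hB : ∀ p, B ≤ W p)
    (hE : ∀ n, Integrable (fun p : X × X => W p * (r n p.1 * r n p.2)) (ν.prod ν))
    {l : Ultrafilter ℕ} {s e : ℝ}
    (hs : Tendsto (fun n => ∫ x, r n x * Real.log (r n x) ∂ν) l (𝓝 s))
    (he : Tendsto (fun n => ∫ p, W p * (r n p.1 * r n p.2) ∂(ν.prod ν)) l (𝓝 e)) :
    ∃ ρ, IsRegularDensity ν ρ ∧ Integrable (fun x => ρ x * Real.log (ρ x)) ν ∧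
      ∫ x, ρ x * Real.log (ρ x) ∂ν ≤ s ∧
      Integrable (fun p : X × X => W p * (ρ p.1 * ρ p.2)) (ν.prod ν) ∧
      ∫ p, W p * (ρ p.1 * ρ p.2) ∂(ν.prod ν) ≤ e := by
  have hac := uniformlyAbsCont_of_entropy_le hr hS hC
  have := fun n => (hr n).isProbabilityMeasure
  obtain ⟨μ, hμν, hμ⟩ := hac.exists_setwiseTendsto l
  have := hμ.isProbabilityMeasure
  obtain ⟨ρ, hρ, rfl⟩ := exists_isRegularDensity hμν
  obtain ⟨h1, h2⟩ := hμ.entropy_le hr hρ hS hs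
  have h3 := hμ.prod hac
  simp only [← IsRegularDensity.densityMeasure_prod (hr _) (hr _),
    ← IsRegularDensity.densityMeasure_prod hρ hρ] at h3
  obtain ⟨h4, h5⟩ := h3.integral_le (fun n => (hr n).prod (hr n)) (hρ.prod hρ) hW hB hE
    (fun n => le_rfl) he
  exact ⟨ρ, hρ, h1, h2, h4, h5⟩

end Density

/-! ### Extended values, regular representatives and the uniform density -/

theorem extIntegral_of_integrable {α : Type*} [MeasurableSpace α] {μ : Measure α} {f : α → ℝ}
    (h : Integrable f μ) : extIntegral μ f = ((∫ x, f x ∂μ : ℝ) : EReal) := if_pos h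

theorem extIntegral_of_not_integrable {α : Type*} [MeasurableSpace α] {μ : Measure α} {f : α → ℝ}
    (h : ¬ Integrable f μ) : extIntegral μ f = ⊤ := if_neg h

theorem extIntegral_congr {α : Type*} [MeasurableSpace α] {μ : Measure α} {f g : α → ℝ}
    (h : f =ᵐ[μ] g) : extIntegral μ f = extIntegral μ g := by
  rw [extIntegral, extIntegral, integrable_congr h, integral_congr_ae h]

variable {d : ℕ} {L : ℝ} [Fact (0 < L)]

theorem IsRegularDensity.isDensity {ρ : Torus d L → ℝ} (h : IsRegularDensity volume ρ) :
    IsDensity ρ :=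
  ⟨h.integrable, ae_of_all _ h.nonneg, h.integral_eq_one⟩

theorem IsDensity.exists_isRegularDensity {ρ : Torus d L → ℝ} (h : IsDensity ρ) :
    ∃ σ, IsRegularDensity volume σ ∧ ρ =ᵐ[volume] σ := by
  have hae : ρ =ᵐ[volume] fun x => max (h.integrable.1.mk ρ x) 0 := by
    filter_upwards [h.integrable.1.ae_eq_mk, h.nonneg] with x hx hx0
    rw [← hx, max_eq_left hx0]
  exact ⟨_, ⟨h.integrable.1.stronglyMeasurable_mk.measurable.max measurable_const,
    fun x => le_max_right _ _, h.integrable.congr hae,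
    (integral_congr_ae hae).symm.trans h.integral_eq_one⟩, hae⟩

theorem entropy_congr {ρ σ : Torus d L → ℝ} (h : ρ =ᵐ[volume] σ) : entropy ρ = entropy σ :=
  extIntegral_congr (h.mono fun x hx => by simp only [hx])

theorem energy_congr {V W ρ σ : Torus d L → ℝ} (hVW : V =ᵐ[volume] W) (h : ρ =ᵐ[volume] σ) :
    energy V ρ ρ = energy W σ σ := by
  refine extIntegral_congr ?_
  filter_upwards [(quasiMeasurePreserving_sub volume volume).ae_eq_comp hVW,
    Measure.quasiMeasurePreserving_fst.ae_eq_comp h,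
    Measure.quasiMeasurePreserving_snd.ae_eq_comp h] with p h1 h2 h3
  simp only [Function.comp_apply] at h1 h2 h3
  rw [h1, h2, h3]

theorem energy_eq_extIntegral (W ρ : Torus d L → ℝ) :
    energy W ρ ρ = extIntegral (volume.prod volume)
      fun p : Torus d L × Torus d L => W (p.1 - p.2) * (ρ p.1 * ρ p.2) := by
  simp only [energy, mul_assoc]

/-- A potential has a measurable representative bounded below everywhere. -/
theorem IsPotential.exists_measurable {a : ℝ} {V : Torus d L → ℝ} (hV : IsPotential a V) :
    ∃ (W : Torus d L → ℝ) (B : ℝ), Measurable W ∧ (∀ x, B ≤ W x) ∧ V =ᵐ[volume] W := by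
  obtain ⟨C, hC⟩ : ∃ C : ℝ, ∀ᵐ x ∂(volume : Measure (Torus d L)), ‖max (-V x) 0‖ ≤ C := by
    have hfin := hV.negPart_bounded.2.ne
    rw [eLpNorm_exponent_top] at hfin
    refine ⟨(eLpNormEssSup (fun x => max (-V x) 0) volume).toReal, ?_⟩
    filter_upwards [ae_le_eLpNormEssSup (f := fun x => max (-V x) 0) (μ := volume)] with x hx
    exact toReal_enorm (max (-V x) 0) ▸
      ENNReal.toReal_mono hfin hx
  refine ⟨fun x => max (hV.integrable.1.mk V x) (-C), -C,
    hV.integrable.1.stronglyMeasurable_mk.measurable.max measurable_const,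
    fun x => le_max_right _ _, ?_⟩
  filter_upwards [hV.integrable.1.ae_eq_mk, hC] with x hx hxC
  rw [← hx, max_eq_left]
  have := (le_max_left (-V x) 0).trans ((le_abs_self _).trans hxC)
  linarith

theorem rho₀_pos : 0 < rho₀ d L := inv_pos.2 (pow_pos Fact.out d)

theorem volume_real_univ : (volume : Measure (Torus d L)).real univ = L ^ d := by
  have hL : 0 < L := Fact.out
  rw [measureReal_def, volume_pi, Measure.pi_univ]
  simp [AddCircle.measure_univ, ENNReal.toReal_ofReal hL.le]

theorem isRegularDensity_rho₀ :
    IsRegularDensity (volume : Measure (Torus d L)) fun _ => rho₀ d L where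
  measurable := measurable_const
  nonneg _ := rho₀_pos.le
  integrable := integrable_const _
  integral_eq_one := by
    have hL : L ^ d ≠ 0 := (pow_pos (Fact.out : 0 < L) d).ne'
    rw [integral_const, volume_real_univ, smul_eq_mul, rho₀, mul_inv_cancel₀ hL]

theorem entropy_rho₀ :
    entropy (fun _ : Torus d L => rho₀ d L) = (Real.log (rho₀ d L) : EReal) := by
  rw [entropy, extIntegral_of_integrable (integrable_const _), integral_mul_const,
    isRegularDensity_rho₀.integral_eq_one, one_mul]

/-- The uniform density minimizes the entropy. -/
theorem log_rho₀_le_integral {ρ : Torus d L → ℝ} (h : IsRegularDensity volume ρ)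
    (hS : Integrable (fun x => ρ x * Real.log (ρ x)) volume) :
    Real.log (rho₀ d L) ≤ ∫ x, ρ x * Real.log (ρ x) := by
  have := h.gibbs hS (g := fun _ => Real.log (rho₀ d L)) (h.integrable.mul_const _)
    (integrable_const _)
  rw [integral_mul_const, h.integral_eq_one, Real.exp_log rho₀_pos,
    isRegularDensity_rho₀.integral_eq_one] at this
  linarith

/-- The shear `(x, y) ↦ (x - y, y)` preserves the product measure, so integrability of `V` suffices
on a torus of finite volume. -/
theorem exists_energy_rho₀ {a : ℝ} {V : Torus d L → ℝ} (hV : IsPotential a V) :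
    ∃ e : ℝ, energy V (fun _ => rho₀ d L) (fun _ => rho₀ d L) = e := by
  have h : Integrable (fun p : Torus d L × Torus d L => V (p.1 - p.2)) (volume.prod volume) :=
    (measurePreserving_sub_prod volume volume).integrable_comp_of_integrable
      (hV.integrable.comp_fst volume)
  exact ⟨_, extIntegral_of_integrable ((h.mul_const _).mul_const _)⟩

/-! ### Finite entropy and energy; real-valued minimality -/

/-- `s` and `e` are the (finite) entropy and interaction energy of the density `ρ`. -/
structure HasValues (V ρ : Torus d L → ℝ) (s e : ℝ) : Prop where
  isDensity : IsDensity ρ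
  entropy_eq : entropy ρ = s
  energy_eq : energy V ρ ρ = e

theorem HasValues.energyTerm_eq {V ρ : Torus d L → ℝ} {s e : ℝ} (h : HasValues V ρ s e) (θ : ℝ) :
    energyTerm V θ ρ = ((1 / 2 * θ * (rho₀ d L)⁻¹ * e : ℝ) : EReal) := by
  rw [energyTerm, h.energy_eq, ← EReal.coe_mul]

theorem HasValues.freeEnergy_eq {V ρ : Torus d L → ℝ} {s e : ℝ} (h : HasValues V ρ s e) (θ : ℝ) :
    freeEnergy V θ ρ = ((s + 1 / 2 * θ * (rho₀ d L)⁻¹ * e : ℝ) : EReal) := by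
  rw [freeEnergy, h.entropy_eq, h.energyTerm_eq, EReal.coe_add]

/-- Finite values are attained by a regular density, with integrable integrands. -/
theorem HasValues.exists_regular {V W ρ : Torus d L → ℝ} {s e : ℝ} (h : HasValues V ρ s e)
    (hVW : V =ᵐ[volume] W) : ∃ σ, IsRegularDensity volume σ ∧
      Integrable (fun x => σ x * Real.log (σ x)) volume ∧ ∫ x, σ x * Real.log (σ x) = s ∧
      Integrable (fun p : Torus d L × Torus d L => W (p.1 - p.2) * (σ p.1 * σ p.2))
        (volume.prod volume) ∧
      ∫ p : Torus d L × Torus d L, W (p.1 - p.2) * (σ p.1 * σ p.2) ∂(volume.prod volume) = e := by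
  obtain ⟨σ, hσ, hρσ⟩ := h.isDensity.exists_isRegularDensity
  have hs := (entropy_congr hρσ).symm.trans h.entropy_eq
  have he := (energy_congr hVW hρσ).symm.trans h.energy_eq
  rw [energy_eq_extIntegral] at he
  have hsi : Integrable (fun x => σ x * Real.log (σ x)) volume := by
    by_contra hn
    rw [entropy, extIntegral_of_not_integrable hn] at hs
    exact EReal.top_ne_coe s hs
  have hei : Integrable (fun p : Torus d L × Torus d L => W (p.1 - p.2) * (σ p.1 * σ p.2))
      (volume.prod volume) := by
    by_contra hn
    rw [extIntegral_of_not_integrable hn] at he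
    exact EReal.top_ne_coe e he
  rw [entropy, extIntegral_of_integrable hsi] at hs
  rw [extIntegral_of_integrable hei] at he
  exact ⟨σ, hσ, hsi, EReal.coe_injective hs, hei, EReal.coe_injective he⟩

theorem hasValues_of_regular {V W σ : Torus d L → ℝ} (hVW : V =ᵐ[volume] W)
    (hσ : IsRegularDensity volume σ)
    (hs : Integrable (fun x => σ x * Real.log (σ x)) volume)
    (he : Integrable (fun p : Torus d L × Torus d L => W (p.1 - p.2) * (σ p.1 * σ p.2))
      (volume.prod volume)) :
    HasValues V σ (∫ x, σ x * Real.log (σ x))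
      (∫ p : Torus d L × Torus d L, W (p.1 - p.2) * (σ p.1 * σ p.2) ∂(volume.prod volume)) :=
  ⟨hσ.isDensity, extIntegral_of_integrable hs, by
    rw [energy_congr hVW ae_eq_rfl, energy_eq_extIntegral, extIntegral_of_integrable he]⟩

theorem HasValues.log_rho₀_le {V ρ : Torus d L → ℝ} {s e : ℝ} (h : HasValues V ρ s e) :
    Real.log (rho₀ d L) ≤ s := by
  obtain ⟨σ, hσ, hs, rfl, -⟩ := h.exists_regular ae_eq_rfl
  exact log_rho₀_le_integral hσ hs

theorem log_rho₀_le_entropy {ρ : Torus d L → ℝ} (h : IsDensity ρ) :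
    (Real.log (rho₀ d L) : EReal) ≤ entropy ρ := by
  obtain ⟨σ, hσ, hρσ⟩ := h.exists_isRegularDensity
  rw [entropy_congr hρσ, entropy]
  by_cases hi : Integrable (fun x => σ x * Real.log (σ x)) volume
  · rw [extIntegral_of_integrable hi]
    exact EReal.coe_le_coe (log_rho₀_le_integral hσ hi)
  · rw [extIntegral_of_not_integrable hi]
    exact le_top

theorem IsPotential.exists_energy_lower_bound {a : ℝ} {V : Torus d L → ℝ} (hV : IsPotential a V) :
    ∃ B : ℝ, ∀ ρ s e, HasValues V ρ s e → B ≤ e := by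
  obtain ⟨W, B, -, hB, hVW⟩ := hV.exists_measurable
  refine ⟨B, fun ρ s e h => ?_⟩
  obtain ⟨σ, hσ, -, -, hi, rfl⟩ := h.exists_regular hVW
  have h2 := hσ.prod hσ
  have := integral_mono (h2.integrable.const_mul B) hi fun p =>
    mul_le_mul_of_nonneg_right (hB _) (h2.nonneg p)
  rwa [integral_const_mul, h2.integral_eq_one, mul_one] at this

theorem IsPotential.exists_hasValues_rho₀ {a : ℝ} {V : Torus d L → ℝ} (hV : IsPotential a V) :
    ∃ e : ℝ, HasValues V (fun _ => rho₀ d L) (Real.log (rho₀ d L)) e := by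
  obtain ⟨e, he⟩ := exists_energy_rho₀ hV
  exact ⟨e, isRegularDensity_rho₀.isDensity, entropy_rho₀, he⟩

theorem coupling_pos {θ : ℝ} (hθ : 0 < θ) : 0 < 1 / 2 * θ * (rho₀ d L)⁻¹ :=
  mul_pos (by positivity) (inv_pos.2 rho₀_pos)

/-- At positive coupling, a density of finite free energy has finite entropy and energy. -/
theorem exists_hasValues_of_freeEnergy_ne_top {V ρ : Torus d L → ℝ} {θ : ℝ} (hθ : 0 < θ)
    (hρ : IsDensity ρ) (h : freeEnergy V θ ρ ≠ ⊤) : ∃ s e : ℝ, HasValues V ρ s e := by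
  have hc := coupling_pos (d := d) (L := L) hθ
  by_cases hE : Integrable (fun p : Torus d L × Torus d L => V (p.1 - p.2) * ρ p.1 * ρ p.2)
      (volume.prod volume)
  · by_cases hS : Integrable (fun x => ρ x * Real.log (ρ x)) volume
    · exact ⟨_, _, hρ, extIntegral_of_integrable hS, extIntegral_of_integrable hE⟩
    · refine absurd ?_ h
      rw [freeEnergy, energyTerm, entropy, energy, extIntegral_of_not_integrable hS,
        extIntegral_of_integrable hE, ← EReal.coe_mul, EReal.top_add_coe]
  · refine absurd ?_ h
    rw [freeEnergy, energyTerm, energy, extIntegral_of_not_integrable hE,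
      EReal.coe_mul_top_of_pos hc, EReal.add_top_of_ne_bot]
    rw [entropy, extIntegral]
    split_ifs
    · exact EReal.coe_ne_bot _
    · exact top_ne_bot

/-- The uniform density has finite free energy, which forces both terms of a minimizer to be finite.
Positivity of `θ` matters: at `θ = 0` the convention `0 · ∞ = 0` hides an infinite interaction. -/
theorem mem_minimizers_iff {a : ℝ} {V ρ : Torus d L → ℝ} (hV : IsPotential a V) {θ : ℝ}
    (hθ : 0 < θ) : ρ ∈ minimizers V θ ↔ ∃ s e, HasValues V ρ s e ∧
      ∀ σ s' e', HasValues V σ s' e' →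
        s + 1 / 2 * θ * (rho₀ d L)⁻¹ * e ≤ s' + 1 / 2 * θ * (rho₀ d L)⁻¹ * e' := by
  constructor
  · rintro ⟨hρ, hmin⟩
    obtain ⟨e₀, h₀⟩ := hV.exists_hasValues_rho₀
    have hle := hmin _ h₀.isDensity
    rw [h₀.freeEnergy_eq] at hle
    obtain ⟨s, e, h⟩ := exists_hasValues_of_freeEnergy_ne_top hθ hρ
      (hle.trans_lt (EReal.coe_lt_top _)).ne
    refine ⟨s, e, h, fun σ s' e' hσ => ?_⟩
    have := hmin σ hσ.isDensity
    rwa [h.freeEnergy_eq, hσ.freeEnergy_eq, EReal.coe_le_coe_iff] at this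
  · rintro ⟨s, e, h, hmin⟩
    refine ⟨h.isDensity, fun σ hσ => ?_⟩
    by_cases htop : freeEnergy V θ σ = ⊤
    · rw [htop]; exact le_top
    · obtain ⟨s', e', h'⟩ := exists_hasValues_of_freeEnergy_ne_top hθ hσ htop
      rw [h.freeEnergy_eq, h'.freeEnergy_eq, EReal.coe_le_coe_iff]
      exact hmin σ s' e' h'

theorem rho₀_mem_minimizers_zero (V : Torus d L → ℝ) :
    (fun _ => rho₀ d L) ∈ minimizers V 0 := by
  refine ⟨isRegularDensity_rho₀.isDensity, fun σ hσ => ?_⟩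
  simpa [freeEnergy, energyTerm, entropy_rho₀] using log_rho₀_le_entropy hσ

/-! ### Existence of minimizers -/

/-- The direct method: minimizers exist at positive coupling. -/
theorem IsPotential.minimizers_nonempty_of_pos {a : ℝ} {V : Torus d L → ℝ}
    (hV : IsPotential a V) {θ : ℝ} (hθ : 0 < θ) : (minimizers V θ).Nonempty := by
  obtain ⟨W, B', hW, hB', hVW⟩ := hV.exists_measurable
  obtain ⟨B, hB⟩ := hV.exists_energy_lower_bound
  obtain ⟨e₀, h₀⟩ := hV.exists_hasValues_rho₀
  set c := 1 / 2 * θ * (rho₀ d L)⁻¹ with hc_def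
  have hc : 0 < c := coupling_pos hθ
  let A : Set ℝ := {f | ∃ ρ s e, HasValues V ρ s e ∧ f = s + c * e}
  have hA : A.Nonempty := ⟨_, _, _, _, h₀, rfl⟩
  have hAb : BddBelow A := ⟨Real.log (rho₀ d L) + c * B, by
    rintro _ ⟨ρ, s, e, h, rfl⟩
    exact add_le_add h.log_rho₀_le (mul_le_mul_of_nonneg_left (hB _ _ _ h) hc.le)⟩
  obtain ⟨u, hu_anti, hu_lim, hu⟩ := exists_seq_tendsto_sInf hA hAb
  choose ρ s e hρ hu_eq using hu
  choose r hr hrS hrs hrE hre using fun n => (hρ n).exists_regular hVW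
  have hu0 : ∀ n, s n + c * e n ≤ u 0 := fun n => hu_eq n ▸ hu_anti (Nat.zero_le n)
  -- The lower bound on each term turns the bound on the sum into an upper bound on the other term.
  have hs_le : ∀ n, s n ≤ u 0 - c * B := fun n => by
    have := mul_le_mul_of_nonneg_left (hB _ _ _ (hρ n)) hc.le
    linarith [hu0 n]
  have he_le : ∀ n, e n ≤ (u 0 - Real.log (rho₀ d L)) / c := fun n => by
    rw [le_div_iff₀ hc, mul_comm]
    linarith [hu0 n, (hρ n).log_rho₀_le]
  -- A single ultrafilter serves the entropies, the energies and the measures.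
  let l : Ultrafilter ℕ := hyperfilter ℕ
  obtain ⟨s', -, hs'⟩ := (isCompact_Icc (a := Real.log (rho₀ d L))
    (b := u 0 - c * B)).ultrafilter_le_nhds' (l.map s)
    (Filter.mem_map.2 (Eventually.of_forall fun n => ⟨(hρ n).log_rho₀_le, hs_le n⟩))
  obtain ⟨e', -, he'⟩ := (isCompact_Icc (a := B)
    (b := (u 0 - Real.log (rho₀ d L)) / c)).ultrafilter_le_nhds' (l.map e)
    (Filter.mem_map.2 (Eventually.of_forall fun n => ⟨hB _ _ _ (hρ n), he_le n⟩))
  have hslim : Tendsto s l (𝓝 s') := hs'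
  have helim : Tendsto e l (𝓝 e') := he'
  have hmin : s' + c * e' = sInf A := by
    refine tendsto_nhds_unique (hslim.add (helim.const_mul c)) ?_
    simp only [← hu_eq]
    exact hu_lim.mono_left Nat.hyperfilter_le_atTop
  obtain ⟨σ, hσ, hσS, hσs, hσE, hσe⟩ := exists_limit_density hr hrS
    (C := u 0 - c * B) (fun n => (hrs n).trans_le (hs_le n))
    (W := fun p : Torus d L × Torus d L => W (p.1 - p.2)) (hW.comp measurable_sub)
    (fun p => hB' _) hrE (l := l) (hslim.congr fun n => (hrs n).symm)
    (helim.congr fun n => (hre n).symm)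
  refine ⟨σ, (mem_minimizers_iff hV hθ).2 ⟨_, _, hasValues_of_regular hVW hσ hσS hσE,
    fun τ s₁ e₁ hτ => ?_⟩⟩
  calc _ ≤ s' + c * e' := add_le_add hσs (mul_le_mul_of_nonneg_left hσe hc.le)
    _ ≤ _ := hmin.trans_le (csInf_le hAb ⟨τ, s₁, e₁, hτ, rfl⟩)

theorem IsPotential.minimizers_nonempty {a : ℝ} {V : Torus d L → ℝ} (hV : IsPotential a V) {θ : ℝ}
    (hθ : 0 ≤ θ) : (minimizers V θ).Nonempty := by
  rcases hθ.eq_or_lt with rfl | hθ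
  · exact ⟨_, rho₀_mem_minimizers_zero V⟩
  · exact hV.minimizers_nonempty_of_pos hθ

/-- There is a minimizer with finite values, whose energy is at most that of the uniform
density. -/
theorem IsPotential.exists_minimizer {a : ℝ} {V : Torus d L → ℝ} (hV : IsPotential a V) {e₀ : ℝ}
    (h₀ : HasValues V (fun _ => rho₀ d L) (Real.log (rho₀ d L)) e₀) {θ : ℝ} (hθ : 0 ≤ θ) :
    ∃ ρ ∈ minimizers V θ, ∃ s e, HasValues V ρ s e ∧ e ≤ e₀ := by
  rcases hθ.eq_or_lt with rfl | hθ
  · exact ⟨_, rho₀_mem_minimizers_zero V, _, _, h₀, le_rfl⟩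
  · obtain ⟨ρ, hρ⟩ := hV.minimizers_nonempty_of_pos hθ
    obtain ⟨s, e, h, hmin⟩ := (mem_minimizers_iff hV hθ).1 hρ
    refine ⟨ρ, hρ, s, e, h, ?_⟩
    have := hmin _ _ _ h₀
    exact le_of_mul_le_mul_left (by linarith [h.log_rho₀_le]) (coupling_pos (d := d) (L := L) hθ)

/-! ### Comparison of minimizers at different couplings -/

theorem HasValues.le_of_mem_minimizers {V ρ σ : Torus d L → ℝ} {s e s' e' θ : ℝ}
    (hρ : HasValues V ρ s e) (hmin : ρ ∈ minimizers V θ) (hσ : HasValues V σ s' e') :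
    s + 1 / 2 * θ * (rho₀ d L)⁻¹ * e ≤ s' + 1 / 2 * θ * (rho₀ d L)⁻¹ * e' := by
  have := hmin.2 σ hσ.isDensity
  rwa [hρ.freeEnergy_eq, hσ.freeEnergy_eq, EReal.coe_le_coe_iff] at this

/-- A minimizer at a larger coupling has smaller energy. -/
theorem HasValues.energy_anti {V ρ σ : Torus d L → ℝ} {s e s' e' θ θ' : ℝ}
    (hρ : HasValues V ρ s e) (hmin : ρ ∈ minimizers V θ) (hσ : HasValues V σ s' e')
    (hmin' : σ ∈ minimizers V θ') (hlt : θ < θ') : e' ≤ e := by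
  have h1 := hρ.le_of_mem_minimizers hmin hσ
  have h2 := hσ.le_of_mem_minimizers hmin' hρ
  refine le_of_mul_le_mul_left ?_ (coupling_pos (d := d) (L := L) (sub_pos.2 hlt))
  -- The sum of the two minimality inequalities: the entropies cancel.
  linarith

/-- A minimizer at a larger coupling has larger entropy. -/
theorem HasValues.entropy_mono {V ρ σ : Torus d L → ℝ} {s e s' e' θ θ' : ℝ} (hθ : 0 ≤ θ)
    (hρ : HasValues V ρ s e) (hmin : ρ ∈ minimizers V θ) (hσ : HasValues V σ s' e')
    (hmin' : σ ∈ minimizers V θ') (hlt : θ < θ') : s ≤ s' := by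
  have h1 := hρ.le_of_mem_minimizers hmin hσ
  have h2 : 1 / 2 * θ * (rho₀ d L)⁻¹ * e' ≤ 1 / 2 * θ * (rho₀ d L)⁻¹ * e :=
    mul_le_mul_of_nonneg_left (hρ.energy_anti hmin hσ hmin' hlt)
      (mul_nonneg (by positivity) (inv_pos.2 rho₀_pos).le)
  linarith

/-! ### Finiteness and monotonicity of the equilibrium quantities -/

theorem Fθ_eq_of_mem_minimizers {V ρ : Torus d L → ℝ} {θ : ℝ} (h : ρ ∈ minimizers V θ) :
    Fθ V θ = freeEnergy V θ ρ :=
  le_antisymm (iInf₂_le ρ h.1) (le_iInf₂ fun σ hσ => h.2 σ hσ)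

theorem IsPotential.exists_Sθ_eq {a : ℝ} {V : Torus d L → ℝ} (hV : IsPotential a V) {θ : ℝ}
    (hθ : 0 ≤ θ) : ∃ s : ℝ, Sθ V θ = s := by
  obtain ⟨e₀, h₀⟩ := hV.exists_hasValues_rho₀
  obtain ⟨ρ, hρ, s, e, h, -⟩ := hV.exists_minimizer h₀ hθ
  have h1 : Sθ V θ ≤ s := h.entropy_eq ▸ iInf₂_le ρ hρ
  have h2 : (Real.log (rho₀ d L) : EReal) ≤ Sθ V θ :=
    le_iInf₂ fun σ hσ => log_rho₀_le_entropy hσ.1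
  exact ⟨_, (EReal.coe_toReal (h1.trans_lt (EReal.coe_lt_top s)).ne
    ((EReal.bot_lt_coe _).trans_le h2).ne').symm⟩

/-- The energy term of every minimizer is finite. -/
theorem IsPotential.exists_energyTerm_eq {a : ℝ} {V ρ : Torus d L → ℝ} (hV : IsPotential a V)
    {θ : ℝ} (hθ : 0 ≤ θ) (hρ : ρ ∈ minimizers V θ) :
    (θ = 0 ∧ energyTerm V θ ρ = 0) ∨ (0 < θ ∧ ∃ s e, HasValues V ρ s e) := by
  rcases hθ.eq_or_lt with rfl | hθ
  · exact Or.inl ⟨rfl, by simp [energyTerm]⟩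
  · obtain ⟨s, e, h, -⟩ := (mem_minimizers_iff hV hθ).1 hρ
    exact Or.inr ⟨hθ, s, e, h⟩

theorem IsPotential.exists_Eθ_eq {a : ℝ} {V : Torus d L → ℝ} (hV : IsPotential a V) {θ : ℝ}
    (hθ : 0 ≤ θ) : ∃ e : ℝ, Eθ V θ = e := by
  obtain ⟨e₀, h₀⟩ := hV.exists_hasValues_rho₀
  obtain ⟨B, hB⟩ := hV.exists_energy_lower_bound
  obtain ⟨ρ, hρ, s, e, h, -⟩ := hV.exists_minimizer h₀ hθ
  have h1 : Eθ V θ ≤ _ := (iInf₂_le ρ hρ).trans_eq (h.energyTerm_eq θ)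
  have h2 : ((1 / 2 * θ * (rho₀ d L)⁻¹ * B : ℝ) : EReal) ≤ Eθ V θ := by
    refine le_iInf₂ fun σ hσ => ?_
    rcases hV.exists_energyTerm_eq hθ hσ with ⟨rfl, h'⟩ | ⟨hpos, s', e', h'⟩
    · simp [h']
    · rw [h'.energyTerm_eq, EReal.coe_le_coe_iff]
      exact mul_le_mul_of_nonneg_left (hB _ _ _ h') (coupling_pos hpos).le
  exact ⟨_, (EReal.coe_toReal (h1.trans_lt (EReal.coe_lt_top _)).ne
    ((EReal.bot_lt_coe _).trans_le h2).ne').symm⟩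

theorem IsPotential.monotoneOn_Sθ {a : ℝ} {V : Torus d L → ℝ} (hV : IsPotential a V) :
    MonotoneOn (fun θ : ℝ => Sθ V θ) (Ici 0) := by
  intro θ hθ θ' hθ' hle
  rcases hle.eq_or_lt with rfl | hlt
  · exact le_rfl
  obtain ⟨e₀, h₀⟩ := hV.exists_hasValues_rho₀
  obtain ⟨ρ, hρ, s, e, h, -⟩ := hV.exists_minimizer h₀ hθ
  refine le_iInf₂ fun σ hσ => ?_
  obtain ⟨s', e', h', -⟩ := (mem_minimizers_iff hV (lt_of_le_of_lt hθ hlt)).1 hσ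
  refine (iInf₂_le ρ hρ).trans ?_
  rw [h.entropy_eq, h'.entropy_eq, EReal.coe_le_coe_iff]
  exact h.entropy_mono hθ hρ h' hσ hlt

/-- The free energy relative to the uniform density is real-valued, non-increasing and Lipschitz
in the coupling. -/
theorem IsPotential.exists_antitone_lipschitz {a : ℝ} {V : Torus d L → ℝ} (hV : IsPotential a V) :
    ∃ (G : ℝ → ℝ) (K : ℝ≥0), (∀ θ ∈ Ici (0 : ℝ),
      Fθ V θ - energyTerm V θ (fun _ => rho₀ d L) = (G θ : EReal)) ∧
      AntitoneOn G (Ici 0) ∧ LipschitzOnWith K G (Ici 0) := by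
  obtain ⟨e₀, h₀⟩ := hV.exists_hasValues_rho₀
  obtain ⟨B, hB⟩ := hV.exists_energy_lower_bound
  set κ : ℝ := 1 / 2 * (rho₀ d L)⁻¹ with hκ
  have hκ0 : 0 ≤ κ := mul_nonneg (by norm_num) (inv_pos.2 rho₀_pos).le
  -- The value at negative `θ` is a dummy that makes `G` total.
  have hex : ∀ θ : ℝ, ∃ g : ℝ, 0 ≤ θ → ∃ ρ ∈ minimizers V θ, ∃ s e, HasValues V ρ s e ∧ e ≤ e₀ ∧
      g = s + θ * κ * (e - e₀) := fun θ => by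
    by_cases hθ : 0 ≤ θ
    · obtain ⟨ρ, hρ, s, e, h, he⟩ := hV.exists_minimizer h₀ hθ
      exact ⟨_, fun _ => ⟨ρ, hρ, s, e, h, he, rfl⟩⟩
    · exact ⟨0, fun h => absurd h hθ⟩
  choose G hG using hex
  -- The minimizer at `θ'` is a competitor at `θ`, with `δ = e' - e₀`. The sign of `δ` gives
  -- monotonicity, its lower bound the Lipschitz constant.
  have hcmp : ∀ θ ∈ Ici (0 : ℝ), ∀ θ' ∈ Ici (0 : ℝ), ∃ δ, B - e₀ ≤ δ ∧ δ ≤ 0 ∧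
      G θ ≤ G θ' + κ * δ * (θ - θ') := fun θ hθ θ' hθ' => by
    obtain ⟨ρ, hρ, s, e, h, he, hg⟩ := hG θ hθ
    obtain ⟨ρ', hρ', s', e', h', he', hg'⟩ := hG θ' hθ'
    refine ⟨e' - e₀, sub_le_sub_right (hB _ _ _ h') _, sub_nonpos.2 he', ?_⟩
    have := h.le_of_mem_minimizers hρ h'
    rw [hg, hg', hκ]
    linarith
  refine ⟨G, (κ * (e₀ - B)).toNNReal, fun θ hθ => ?_, fun θ hθ θ' hθ' hle => ?_,
    LipschitzOnWith.of_le_add_mul _ fun θ hθ θ' hθ' => ?_⟩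
  · obtain ⟨ρ, hρ, s, e, h, he, hg⟩ := hG θ hθ
    rw [Fθ_eq_of_mem_minimizers hρ, h.freeEnergy_eq, h₀.energyTerm_eq, ← EReal.coe_sub, hg, hκ]
    congr 1
    ring
  · obtain ⟨δ, -, hδ, h⟩ := hcmp θ' hθ' θ hθ
    have : κ * δ * (θ' - θ) ≤ 0 :=
      mul_nonpos_of_nonpos_of_nonneg (mul_nonpos_of_nonneg_of_nonpos hκ0 hδ) (sub_nonneg.2 hle)
    linarith
  · obtain ⟨δ, hδB, hδ, h⟩ := hcmp θ hθ θ' hθ'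
    refine h.trans (add_le_add_right ?_ _)
    rw [Real.coe_toNNReal _ (mul_nonneg hκ0 (by linarith)), Real.dist_eq]
    refine (le_abs_self _).trans ?_
    rw [abs_mul, abs_mul, abs_of_nonneg hκ0, abs_of_nonpos hδ]
    gcongr
    linarith

/-- Dividing by `θ` leaves a fixed multiple of the interaction, so one minimizer at `θ'` separates
the two infima: its interaction lies below that of every minimizer at `θ`. -/
theorem IsPotential.antitoneOn_inv_mul_Eθ {a : ℝ} {V : Torus d L → ℝ} (hV : IsPotential a V) :
    AntitoneOn (fun θ : ℝ => ((θ⁻¹ : ℝ) : EReal) * Eθ V θ) (Ioi 0) := by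
  intro θ hθ θ' hθ' hle
  rw [mem_Ioi] at hθ hθ'
  rcases hle.eq_or_lt with rfl | hlt
  · exact le_rfl
  obtain ⟨E, hE⟩ := hV.exists_Eθ_eq hθ.le
  obtain ⟨E', hE'⟩ := hV.exists_Eθ_eq hθ'.le
  obtain ⟨σ, hσ⟩ := hV.minimizers_nonempty_of_pos hθ'
  obtain ⟨s', e', h', -⟩ := (mem_minimizers_iff hV hθ').1 hσ
  have hE'le : E' ≤ 1 / 2 * θ' * (rho₀ d L)⁻¹ * e' := by
    rw [← EReal.coe_le_coe_iff, ← h'.energyTerm_eq, ← hE']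
    exact iInf₂_le σ hσ
  have hEge : 1 / 2 * θ * (rho₀ d L)⁻¹ * e' ≤ E := by
    rw [← EReal.coe_le_coe_iff, ← hE]
    refine le_iInf₂ fun ρ hρ => ?_
    obtain ⟨s, e, h, -⟩ := (mem_minimizers_iff hV hθ).1 hρ
    rw [h.energyTerm_eq, EReal.coe_le_coe_iff]
    exact mul_le_mul_of_nonneg_left (h.energy_anti hρ h' hσ hlt) (coupling_pos hθ).le
  simp only [hE, hE', ← EReal.coe_mul, EReal.coe_le_coe_iff]
  calc θ'⁻¹ * E' ≤ θ'⁻¹ * (1 / 2 * θ' * (rho₀ d L)⁻¹ * e') := by gcongr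
    _ = θ⁻¹ * (1 / 2 * θ * (rho₀ d L)⁻¹ * e') := by field_simp
    _ ≤ θ⁻¹ * E := by gcongr

theorem IsPotential.antitoneOn_Eθ_sub {a : ℝ} {V : Torus d L → ℝ} (hV : IsPotential a V) :
    AntitoneOn (fun θ : ℝ => Eθ V θ - energyTerm V θ (fun _ => rho₀ d L)) (Ici 0) := by
  intro θ hθ θ' hθ' hle
  rw [mem_Ici] at hθ hθ'
  rcases hle.eq_or_lt with rfl | hlt
  · exact le_rfl
  obtain ⟨e₀, h₀⟩ := hV.exists_hasValues_rho₀
  obtain ⟨E, hE⟩ := hV.exists_Eθ_eq hθ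
  obtain ⟨E', hE'⟩ := hV.exists_Eθ_eq hθ'
  obtain ⟨σ, hσ, s', e', h', he'⟩ := hV.exists_minimizer h₀ hθ'
  have hE'le : E' ≤ 1 / 2 * θ' * (rho₀ d L)⁻¹ * e' := by
    rw [← EReal.coe_le_coe_iff, ← h'.energyTerm_eq, ← hE']
    exact iInf₂_le σ hσ
  have hEge : 1 / 2 * θ * (rho₀ d L)⁻¹ * e' ≤ E := by
    rw [← EReal.coe_le_coe_iff, ← hE]
    refine le_iInf₂ fun ρ hρ => ?_
    rcases hV.exists_energyTerm_eq hθ hρ with ⟨rfl, h⟩ | ⟨hpos, s, e, h⟩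
    · simp [h]
    · rw [h.energyTerm_eq, EReal.coe_le_coe_iff]
      exact mul_le_mul_of_nonneg_left (h.energy_anti hρ h' hσ hlt) (coupling_pos hpos).le
  simp only [hE, hE', h₀.energyTerm_eq, ← EReal.coe_sub, EReal.coe_le_coe_iff]
  -- Passing from `θ` to `θ'` at fixed interaction `e'` changes the difference by a nonnegative
  -- multiple of `e' - e₀ ≤ 0`.
  have := mul_le_mul_of_nonneg_left he' (coupling_pos (d := d) (L := L) (sub_pos.2 hlt)).le
  linarith

end McKeanVlasov

theorem mainTheorem10 (d : ℕ) (L : ℝ) [Fact (0 < L)] (a : ℝ) (ha : a < L)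
    (V : McKeanVlasov.Torus d L → ℝ) (hV : McKeanVlasov.IsPotential a V) :
    (∀ θ : ℝ, 0 ≤ θ →
      (McKeanVlasov.minimizers V θ).Nonempty ∧
      (∃ s : ℝ, McKeanVlasov.Sθ V θ = s) ∧
      (∃ e : ℝ, McKeanVlasov.Eθ V θ = e) ∧
      (∃ f : ℝ, McKeanVlasov.Fθ V θ = f)) ∧
    MonotoneOn (fun θ : ℝ => McKeanVlasov.Sθ V θ) (Set.Ici 0) ∧
    AntitoneOn (fun θ : ℝ => McKeanVlasov.Fθ V θ
      - McKeanVlasov.energyTerm V θ (fun _ => McKeanVlasov.rho₀ d L)) (Set.Ici 0) ∧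
    ContinuousOn (fun θ : ℝ => McKeanVlasov.Fθ V θ
      - McKeanVlasov.energyTerm V θ (fun _ => McKeanVlasov.rho₀ d L)) (Set.Ici 0) ∧
    AntitoneOn (fun θ : ℝ => ((θ⁻¹ : ℝ) : EReal) * McKeanVlasov.Eθ V θ) (Set.Ioi 0) ∧
    AntitoneOn (fun θ : ℝ => McKeanVlasov.Eθ V θ
      - McKeanVlasov.energyTerm V θ (fun _ => McKeanVlasov.rho₀ d L)) (Set.Ici 0) := by
  obtain ⟨G, K, hG, hanti, hlip⟩ := hV.exists_antitone_lipschitz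
  refine ⟨fun θ hθ => ⟨hV.minimizers_nonempty hθ, hV.exists_Sθ_eq hθ, hV.exists_Eθ_eq hθ, ?_⟩,
    hV.monotoneOn_Sθ, ?_, ?_, hV.antitoneOn_inv_mul_Eθ, hV.antitoneOn_Eθ_sub⟩
  · obtain ⟨e₀, h₀⟩ := hV.exists_hasValues_rho₀
    obtain ⟨ρ, hρ, s, e, h, -⟩ := hV.exists_minimizer h₀ hθ
    exact ⟨_, (McKeanVlasov.Fθ_eq_of_mem_minimizers hρ).trans (h.freeEnergy_eq θ)⟩
  · intro θ hθ θ' hθ' hle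
    simp only [hG θ hθ, hG θ' hθ']
    exact EReal.coe_le_coe (hanti hθ hθ' hle)
  · exact (continuous_coe_real_ereal.comp_continuousOn hlip.continuousOn).congr hG
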